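/- Let $\mathbb K$ be an algebraically closed field of characteristic zero, and let $X$ be an affine toric variety over $\mathbb K$, not necessarily normal: an irreducible affine variety on which a torus $T=(\mathbb K^\times)^n$ acts algebraically with an open orbit. The algebra $\mathbb K[X]$ is graded by the character group $\mathbb Z^n$ of $T$, the component of degree $m$ consisting of the semi-invariants of weight $m$; a derivation $D$ of $\mathbb K[X]$ is homogeneous if there is $e\in\mathbb Z^n$ such that $D$ maps the component of degree $m$ into the component of degree $m+e$ for every $m$. An LND of a $\mathbb K$-algebra is a $\mathbb K$-derivation $D$ such that every element is annihilated by some power of $D$; a slice of $D$ is an element $s$ with $Ds=1$. Let $\mathrm{ML}_h(X)$ be the intersection of the kernels of all homogeneous LNDs of $\mathbb K[X]$, and let $\mathrm{ML}^*_h(X)$ be the intersection of the kernels of all homogeneous LNDs of $\mathbb K[X]$ that have a slice (so $\mathrm{ML}^*_h(X)=\mathbb K[X]$ if there are none). Then $\mathrm{ML}^*_h(X)$ is a $T$-stable subalgebra of $\mathbb K[X]$ which, with the induced action of $T$, is the coordinate ring of an affine toric variety $X'$, and there is a surjective $T$-equivariant homomorphism of $\mathbb K$-algebras $\mathbb K[X]\to\mathrm{ML}^*_h(X)$,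 so that $X'$ is a closed $T$-stable subvariety of $X$. The variety $X'$ is rigid, that is, $\mathrm{ML}^*_h(X)$ has no nonzero LND, if and only if $\mathrm{ML}^*_h(X)=\mathrm{ML}_h(X)$. -/

import Mathlib

namespace AffineToric

/-- The torus `(Kˣ)ⁿ`. -/
abbrev Torus (K : Type*) [Field K] (n : ℕ) : Type _ := Fin n → Kˣ

/-- The character `χ^m : t ↦ ∏ i, t i ^ m i` of the torus, for `m ∈ ℤⁿ`. -/
def character {K : Type*} [Field K] {n : ℕ} (m : Fin n → ℤ) (t : Torus K n) : Kˣ :=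
  ∏ i, t i ^ m i

/-- The affine variety `X` with coordinate ring `B = K[X]` is a (not necessarily normal) affine
toric variety under the action of the torus `T = (Kˣ)ⁿ`. The action is given on regular functions,
`(ρ t f)(x) = f (t • x)`. Points of `X` are maximal ideals of `B`, with the Zariski topology, and
`t • x` is the preimage of the ideal `x` under `ρ t`. -/
structure IsAffineToric (K : Type*) [Field K] {n : ℕ} {B : Type*} [CommRing B] [Algebra K B]
    (ρ : Torus K n →* (B ≃ₐ[K] B)) : Prop where
  /-- `X` is an affine algebraic variety -/
  finiteType : Algebra.FiniteType K B
  /-- which is irreducible (and reduced) -/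
  isDomain : IsDomain B
  /-- The action map `T × X → X` is a morphism: the function `(t, x) ↦ b (t • x)` is a regular
  function on `T × X`, that is, a Laurent polynomial in `t` with coefficients in `B`. -/
  algebraic : ∀ b : B, ∃ c : (Fin n → ℤ) →₀ B,
    ∀ t : Torus K n, ρ t b = c.sum fun m b' => (character m t : K) • b'
  /-- Some orbit is open. -/
  openOrbit : ∃ x : MaximalSpectrum B,
    IsOpen {y : MaximalSpectrum B | ∃ t : Torus K n, y.asIdeal = x.asIdeal.comap (ρ t)}

/-- The homogeneous component of degree `m` of `B` in the grading by the character group of the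
torus: the `T`-semi-invariants of weight `m`. -/
def weightSpace {K : Type*} [Field K] {n : ℕ} {B : Type*} [CommRing B] [Algebra K B]
    (ρ : Torus K n →* (B ≃ₐ[K] B)) (m : Fin n → ℤ) : Submodule K B where
  carrier := {b | ∀ t, ρ t b = (character m t : K) • b}
  zero_mem' := by intro t; simp
  add_mem' := by intro a b ha hb t; simp [ha t, hb t]
  smul_mem' := by intro c b hb t; simp [hb t, smul_comm c]

/-- The set `LND(B)` of locally nilpotent `K`-derivations of `B`. -/
def LND (K B : Type*) [Field K] [CommRing B] [Algebra K B] : Set (Derivation K B B) :=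
  {D | ∀ b : B, ∃ k : ℕ, (D : B → B)^[k] b = 0}

/-- The set `LND^*(B)` of locally nilpotent derivations with a slice. -/
def LNDStar (K B : Type*) [Field K] [CommRing B] [Algebra K B] : Set (Derivation K B B) :=
  {D | D ∈ LND K B ∧ ∃ s : B, D s = 1}

/-- A derivation is homogeneous if, for some `e`, it maps the component of every degree `m` to the
component of degree `m + e`. -/
def IsHomogeneous {K : Type*} [Field K] {n : ℕ} {B : Type*} [CommRing B] [Algebra K B]
    (ρ : Torus K n →* (B ≃ₐ[K] B)) (D : Derivation K B B) : Prop :=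
  ∃ e : Fin n → ℤ, ∀ m : Fin n → ℤ, ∀ f ∈ weightSpace ρ m, D f ∈ weightSpace ρ (m + e)

/-- The set `LND_h(B)` of homogeneous locally nilpotent derivations. -/
def LNDh {K : Type*} [Field K] {n : ℕ} {B : Type*} [CommRing B] [Algebra K B]
    (ρ : Torus K n →* (B ≃ₐ[K] B)) : Set (Derivation K B B) :=
  {D | D ∈ LND K B ∧ IsHomogeneous ρ D}

/-- The intersection of the kernels of the derivations in `S` (all of `B` if `S` is empty). -/
def kernels {K B : Type*} [Field K] [CommRing B] [Algebra K B] (S : Set (Derivation K B B)) :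
    Subalgebra K B where
  carrier := {b | ∀ D ∈ S, D b = 0}
  mul_mem' := by intro a b ha hb D hD; simp [ha D hD, hb D hD]
  add_mem' := by intro a b ha hb D hD; simp [ha D hD, hb D hD]
  algebraMap_mem' := by intro r D _; simp

/-- `ML_h(X)`: the intersection of the kernels of all homogeneous LNDs of `K[X]`. -/
def MLh {K : Type*} [Field K] {n : ℕ} {B : Type*} [CommRing B] [Algebra K B]
    (ρ : Torus K n →* (B ≃ₐ[K] B)) : Subalgebra K B :=
  kernels (LNDh ρ)

/-- `ML^*_h(X)`: the intersection of the kernels of all homogeneous LNDs of `K[X]` that have a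
slice. -/
def MLhStar {K : Type*} [Field K] {n : ℕ} {B : Type*} [CommRing B] [Algebra K B]
    (ρ : Torus K n →* (B ≃ₐ[K] B)) : Subalgebra K B :=
  kernels (LNDh ρ ∩ LNDStar K B)

/-- The variety with coordinate ring `A` is rigid: `A` has no nonzero LND. -/
def IsRigid (K A : Type*) [Field K] [CommRing A] [Algebra K A] : Prop :=
  ∀ D ∈ LND K A, D = 0

end AffineToric

/-!
The coordinate ring `B` of an affine toric variety is the algebra of a monoid `M ⊆ ℤⁿ`: normalizing
semi-invariants to take the value `1` at a point of the open orbit gives a basis `b` of `B`, indexed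
by the set `M` of weights, with `b (m + m') = b m * b m'` (`exists_isWeightBasis`). Every homogeneous
derivation sends each `b m` to a multiple of some `b m'`. Since the kernel of a locally nilpotent
derivation of a domain of characteristic zero is factorially closed (`apply_eq_zero_of_mul`), the
common kernel of homogeneous ones is spanned by the `b m` with `m` in a face `F` of `M`
(`isFaceSubalgebra_kernels`). Annihilating all `b m` with `m ∉ F` is therefore an equivariant
retraction of `B` onto it. The torus orbit of the point with all coordinates `1` of a monoid algebra
is the locus where no generator vanishes, because characters of a submonoid of `ℤⁿ` with values in
the divisible group `Kˣ` extend to `ℤⁿ` (`exists_isOpen_orbit`); so the face algebra is again toric.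

For the criterion, a homogeneous derivation with a slice splits off a free summand `ℕ u` from `M`
(`exists_slice_splitting`). Splitting off such summands one after another leads to a retraction `p`
of `M` onto the face `F` of `A = ML^*_h` with `m - p m ∈ M` for all `m` (`exists_retraction`). Write
`q m = m - p m`.

* A nonzero locally nilpotent derivation of `A` extends to `B` by zero on all `b (q m)`. Its
  homogeneous component of largest degree in the lexicographic order is nonzero, locally nilpotent
  and also kills all `b (q m)` (`exists_homogeneous_LND`), so it does not vanish on `A`; thus
  `A ≠ ML_h`.
* Conversely, let a homogeneous locally nilpotent `D` not vanish on `A`. The projection `P : B → A`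
  with `P (b m) = b (p m)` is an algebra homomorphism, so `P ∘ D` restricts to a derivation of `A`.
  It is nonzero since `P` maps no `b m` to zero, and locally nilpotent since `b (p m)` divides `b m`:
  passing from `b m` to `b (p m)` does not raise the degree function of `D`
  (`iterate_eq_zero_of_mul`). Thus `A` is not rigid.
-/

namespace AffineToric

open Module

/-! ### Locally nilpotent derivations -/

section LocallyNilpotent

variable {K B : Type*} [Field K] [CommRing B] [Algebra K B]

theorem iterate_eq_zero_of_le {D : Derivation K B B} {x : B} {k l : ℕ} (hkl : k ≤ l)
    (h : (D : B → B)^[k] x = 0) : (D : B → B)^[l] x = 0 := by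
  obtain ⟨j, rfl⟩ := Nat.exists_eq_add_of_le' hkl
  rw [Function.iterate_add_apply, h, iterate_map_zero]

theorem iterate_smul (D : Derivation K B B) (k : ℕ) (c : K) (x : B) :
    (D : B → B)^[k] (c • x) = c • (D : B → B)^[k] x :=
  Function.Commute.iterate_left (fun x => D.map_smul c x) k x

/-- The extreme term of the Leibniz rule for iterates. -/
theorem iterate_mul_of_iterate_succ_eq_zero (D : Derivation K B B) (N M : ℕ) (x y : B)
    (hx : (D : B → B)^[N + 1] x = 0) (hy : (D : B → B)^[M + 1] y = 0) :
    (D : B → B)^[N + M] (x * y) =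
      ((N + M).choose N : B) * ((D : B → B)^[N] x * (D : B → B)^[M] y) := by
  induction hk : N + M generalizing N M x y with
  | zero =>
    obtain ⟨rfl, rfl⟩ : N = 0 ∧ M = 0 := by omega
    simp
  | succ k ih =>
    rw [Function.iterate_succ_apply, D.leibniz, smul_eq_mul, smul_eq_mul, iterate_map_add]
    rcases N with _ | N
    · rcases M with _ | M
      · omega
      · have h0 : D x = 0 := hx
        have := ih 0 M x (D y) hx hy (by omega)
        rw [h0, this]
        simp
    · rcases M with _ | M
      · have h0 : D y = 0 := hy
        have := ih N 0 (D x) y hx hy (by omega)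
        rw [h0, mul_comm y, this]
        obtain rfl : k = N := by omega
        simp
      · have h1 := ih (N + 1) M x (D y) hx hy (by omega)
        have h2 := ih N (M + 1) (D x) y hx hy (by omega)
        rw [h1, mul_comm y, h2, Nat.choose_succ_succ, Function.iterate_succ_apply,
          Function.iterate_succ_apply]
        push_cast
        ring

theorem exists_last_iterate {D : Derivation K B B} (hD : D ∈ LND K B) {x : B} (hx : x ≠ 0) :
    ∃ N, (D : B → B)^[N] x ≠ 0 ∧ (D : B → B)^[N + 1] x = 0 := by
  classical
  have hne : Nat.find (hD x) ≠ 0 := fun h => hx (by simpa [h] using Nat.find_spec (hD x))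
  obtain ⟨N, hN⟩ := Nat.exists_eq_succ_of_ne_zero hne
  exact ⟨N, Nat.find_min (hD x) (by omega), by simpa [hN] using Nat.find_spec (hD x)⟩

/-- The degree function of a locally nilpotent derivation satisfies `deg x ≤ deg (x * y)` for
`y ≠ 0`. -/
theorem iterate_eq_zero_of_mul [IsDomain B] [CharZero K] {D : Derivation K B B}
    (hD : D ∈ LND K B) {x y : B} (hy : y ≠ 0) {k : ℕ} (h : (D : B → B)^[k] (x * y) = 0) :
    (D : B → B)^[k] x = 0 := by
  by_contra hx
  have hx0 : x ≠ 0 := by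
    rintro rfl
    exact hx (iterate_map_zero _ _)
  obtain ⟨N, hN, hN'⟩ := exists_last_iterate hD hx0
  obtain ⟨M, hM, hM'⟩ := exists_last_iterate hD hy
  have hkN : k ≤ N := by
    by_contra! hlt
    exact hx (iterate_eq_zero_of_le hlt hN')
  have h0 := iterate_eq_zero_of_le (l := N + M) (by omega) h
  rw [iterate_mul_of_iterate_succ_eq_zero D N M x y hN' hM'] at h0
  have : CharZero B := charZero_of_injective_algebraMap (algebraMap K B).injective
  refine mul_ne_zero ?_ (mul_ne_zero hN hM) h0
  exact_mod_cast (Nat.choose_pos (Nat.le_add_right N M)).ne'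

/-- The kernel of a locally nilpotent derivation is factorially closed. -/
theorem apply_eq_zero_of_mul [IsDomain B] [CharZero K] {D : Derivation K B B}
    (hD : D ∈ LND K B) {x y : B} (hy : y ≠ 0) (h : D (x * y) = 0) : D x = 0 :=
  iterate_eq_zero_of_mul (k := 1) hD hy h

theorem mem_LND_of_basis {ι : Type*} (b : Basis ι K B) {D : Derivation K B B}
    (h : ∀ i, ∃ k, (D : B → B)^[k] (b i) = 0) : D ∈ LND K B := by
  intro x
  induction b.mem_span x using Submodule.span_induction with
  | zero => exact ⟨0, rfl⟩
  | mem x hx =>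
    obtain ⟨i, rfl⟩ := hx
    exact h i
  | add x y _ _ hx hy =>
    obtain ⟨k, hk⟩ := hx
    obtain ⟨l, hl⟩ := hy
    refine ⟨max k l, ?_⟩
    rw [iterate_map_add, iterate_eq_zero_of_le (le_max_left k l) hk,
      iterate_eq_zero_of_le (le_max_right k l) hl, add_zero]
  | smul c x _ hx =>
    obtain ⟨k, hk⟩ := hx
    refine ⟨k, ?_⟩
    rw [iterate_smul, hk, smul_zero]

theorem derivation_eq_zero_of_basis {ι : Type*} (b : Basis ι K B) {D : Derivation K B B}
    (h : ∀ i, D (b i) = 0) : D = 0 := by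
  have : (D : B →ₗ[K] B) = 0 := b.ext h
  ext x
  exact LinearMap.congr_fun this x

theorem bilinear_ext_basis {ι : Type*} (b : Basis ι K B) {C : Type*} [AddCommGroup C] [Module K C]
    {f g : B →ₗ[K] B →ₗ[K] C} (h : ∀ i j, f (b i) (b j) = g (b i) (b j)) : f = g :=
  b.ext fun i => b.ext fun j => h i j

end LocallyNilpotent

/-! ### Multiplicative bases -/

section MultiplicativeBasis

variable {K B M : Type*} [Field K] [CommRing B] [Algebra K B] [AddCommMonoid M]

/-- A basis `b` of an algebra, indexed by a commutative monoid, with `b (m + m') = b m * b m'`: it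
identifies the algebra with the monoid algebra of `M`. -/
structure IsMultiplicativeBasis (b : Basis M K B) : Prop where
  map_zero : b 0 = 1
  map_add : ∀ m m', b (m + m') = b m * b m'

namespace IsMultiplicativeBasis

variable {b : Basis M K B}

/-- The algebra homomorphism with prescribed multiplicative values on a multiplicative basis. -/
noncomputable def algHom {C : Type*} [CommRing C] [Algebra K C] (hb : IsMultiplicativeBasis b)
    (f : M → C) (h0 : f 0 = 1) (hadd : ∀ m m', f (m + m') = f m * f m') : B →ₐ[K] C :=
  AlgHom.ofLinearMap (b.constr K f) (by rw [← hb.map_zero, b.constr_basis, h0]) fun x y => by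
    have : (LinearMap.mul K B).compr₂ (b.constr K f) =
        (LinearMap.mul K C).compl₁₂ (b.constr K f) (b.constr K f) :=
      bilinear_ext_basis b fun m m' => by simp [← hb.map_add, hadd, b.constr_basis]
    exact LinearMap.congr_fun (LinearMap.congr_fun this x) y

theorem algHom_apply {C : Type*} [CommRing C] [Algebra K C] (hb : IsMultiplicativeBasis b)
    (f : M → C) (h0 : f 0 = 1) (hadd : ∀ m m', f (m + m') = f m * f m') (m : M) :
    hb.algHom f h0 hadd (b m) = f m :=
  b.constr_basis K f m

/-- The derivation with prescribed values on a multiplicative basis. -/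
noncomputable def derivation (hb : IsMultiplicativeBasis b) (d : M → B)
    (hd : ∀ m m', d (m + m') = b m * d m' + b m' * d m) : Derivation K B B :=
  Derivation.mk' (b.constr K d) fun x y => by
    have : (LinearMap.mul K B).compr₂ (b.constr K d) =
        (LinearMap.mul K B).compl₁₂ LinearMap.id (b.constr K d) +
          ((LinearMap.mul K B).compl₁₂ LinearMap.id (b.constr K d)).flip :=
      bilinear_ext_basis b fun m m' => by simp [← hb.map_add, hd, b.constr_basis]
    exact LinearMap.congr_fun (LinearMap.congr_fun this x) y

theorem derivation_apply (hb : IsMultiplicativeBasis b) (d : M → B)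
    (hd : ∀ m m', d (m + m') = b m * d m' + b m' * d m) (m : M) :
    hb.derivation d hd (b m) = d m :=
  b.constr_basis K d m

end IsMultiplicativeBasis

end MultiplicativeBasis

/-! ### Characters of the torus -/

section Weights

variable {K : Type*} [Field K] {n : ℕ}

theorem character_add (m m' : Fin n → ℤ) (t : Torus K n) :
    character (m + m') t = character m t * character m' t := by
  simp [character, zpow_add, Finset.prod_mul_distrib]

theorem character_zero (t : Torus K n) : character 0 t = 1 := by simp [character]

theorem character_map_one (m : Fin n → ℤ) : character m (1 : Torus K n) = 1 := by simp [character]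

theorem character_map_mul (m : Fin n → ℤ) (s t : Torus K n) :
    character m (s * t) = character m s * character m t := by
  simp [character, mul_zpow, Finset.prod_mul_distrib]

theorem character_injective [CharZero K] :
    Function.Injective (character : (Fin n → ℤ) → Torus K n → Kˣ) := by
  intro m m' h
  ext i
  have h2 : (2 : K) ≠ 0 := two_ne_zero
  have hval : ∀ μ : Fin n → ℤ,
      character μ (Pi.mulSingle i (Units.mk0 2 h2)) = Units.mk0 (2 : K) h2 ^ μ i := by
    intro μ
    rw [character, Finset.prod_eq_single i]
    · simp
    · intro j _ hj
      simp [Pi.mulSingle_eq_of_ne hj]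
    · simp
  have h1 := congrFun h (Pi.mulSingle i (Units.mk0 2 h2))
  rw [hval, hval] at h1
  have h3 : ((2 : ℚ) ^ m i : ℚ) = 2 ^ m' i := by
    refine Rat.cast_injective (α := K) ?_
    simpa using congrArg Units.val h1
  exact zpow_right_injective₀ (by norm_num) (by norm_num) h3

variable {B : Type*} [CommRing B] [Algebra K B]

/-- Characters of the torus are linearly independent over any domain containing the base field. -/
theorem linearIndependent_character [CharZero K] [IsDomain B] :
    LinearIndependent B fun (m : Fin n → ℤ) (t : Torus K n) =>
      algebraMap K B (character m t) := by
  let f : (Fin n → ℤ) → Torus K n →* B := fun m =>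
    { toFun := fun t => algebraMap K B (character m t)
      map_one' := by simp [character_map_one]
      map_mul' := by simp [character_map_mul] }
  have hf : Function.Injective f := fun m m' h => character_injective <| funext fun t =>
    Units.ext <| (algebraMap K B).injective <| DFunLike.congr_fun h t
  exact (linearIndependent_monoidHom (Torus K n) B).comp f hf

/-- Comparison of coefficients: two Laurent polynomials in `t`, with coefficients in a domain,
coincide if they have the same values at all points of the torus. -/
theorem finsupp_eq_of_character_sum_eq [CharZero K] [IsDomain B] {c c' : (Fin n → ℤ) →₀ B}
    (h : ∀ t : Torus K n, (c.sum fun m x => (character m t : K) • x) =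
      c'.sum fun m x => (character m t : K) • x) : c = c' := by
  refine linearIndependent_character (K := K) (B := B) (n := n) ?_
  funext t
  have := h t
  simp only [Algebra.smul_def] at this
  simp only [Finsupp.linearCombination_apply, Finsupp.sum, Finset.sum_apply, Pi.smul_apply,
    smul_eq_mul]
  simp only [Finsupp.sum] at this
  simpa only [mul_comm] using this

end Weights

/-! ### Bases of semi-invariants -/

section WeightBasis

variable {K : Type*} [Field K] {n : ℕ} {B : Type*} [CommRing B] [Algebra K B]

/-- A multiplicative basis consisting of semi-invariants of pairwise distinct weights `wt m`. Such a
basis identifies `B` with the algebra of the submonoid `wt '' M` of `ℤⁿ`, the torus acting on it in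
the standard way. -/
structure IsWeightBasis (ρ : Torus K n →* (B ≃ₐ[K] B)) {M : Type*} [AddCommMonoid M]
    (wt : M →+ (Fin n → ℤ)) (b : Basis M K B) : Prop extends IsMultiplicativeBasis b where
  wt_injective : Function.Injective wt
  apply_basis : ∀ t m, ρ t (b m) = (character (wt m) t : K) • b m

variable {ρ : Torus K n →* (B ≃ₐ[K] B)} {M : Type*} [AddCommMonoid M]
  {wt : M →+ (Fin n → ℤ)} {b : Basis M K B}

namespace IsWeightBasis

theorem add_left_cancel' (hb : IsWeightBasis ρ wt b) {m m₁ m₂ : M} (h : m + m₁ = m + m₂) :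
    m₁ = m₂ := by
  refine hb.wt_injective (add_left_cancel (a := wt m) ?_)
  rw [← map_add, h, map_add]

theorem basis_mem_weightSpace (hb : IsWeightBasis ρ wt b) (m : M) :
    b m ∈ weightSpace ρ (wt m) := fun t => hb.apply_basis t m

theorem repr_apply (hb : IsWeightBasis ρ wt b) (t : Torus K n) (x : B) (m : M) :
    b.repr (ρ t x) m = (character (wt m) t : K) * b.repr x m := by
  have : b.coord m ∘ₗ (ρ t).toLinearMap = (character (wt m) t : K) • b.coord m := by
    refine b.ext fun m' => ?_
    by_cases h : m' = m
    · subst h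
      simp [hb.apply_basis]
    · simp [hb.apply_basis, Finsupp.single_eq_of_ne' h]
  exact LinearMap.congr_fun this x

theorem wt_eq_of_mem_weightSpace [CharZero K] (hb : IsWeightBasis ρ wt b) {μ : Fin n → ℤ} {x : B}
    (hx : x ∈ weightSpace ρ μ) {m : M} (hm : b.repr x m ≠ 0) : wt m = μ := by
  refine character_injective (K := K) (funext fun t => Units.ext ?_)
  have h := hb.repr_apply t x m
  rw [hx t, map_smul, Finsupp.smul_apply, smul_eq_mul] at h
  exact (mul_right_cancel₀ hm h).symm

theorem mem_weightSpace_iff [CharZero K] (hb : IsWeightBasis ρ wt b) {μ : Fin n → ℤ} {x : B} :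
    x ∈ weightSpace ρ μ ↔ ∀ m, b.repr x m ≠ 0 → wt m = μ := by
  refine ⟨fun hx m hm => hb.wt_eq_of_mem_weightSpace hx hm, fun h t => b.repr.injective ?_⟩
  ext m
  rw [hb.repr_apply, map_smul, Finsupp.smul_apply, smul_eq_mul]
  by_cases hm : b.repr x m = 0
  · rw [hm, mul_zero, mul_zero]
  · rw [h m hm]

/-- The weight spaces have dimension at most one. -/
theorem exists_eq_smul_basis [CharZero K] (hb : IsWeightBasis ρ wt b) {μ : Fin n → ℤ} {x : B}
    (hx : x ∈ weightSpace ρ μ) (hx0 : x ≠ 0) : ∃ m, wt m = μ ∧ ∃ c : K, c ≠ 0 ∧ x = c • b m := by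
  obtain ⟨m, hm⟩ : ∃ m, b.repr x m ≠ 0 := by
    by_contra! h
    exact hx0 (b.repr.map_eq_zero_iff.mp (Finsupp.ext h))
  refine ⟨m, hb.wt_eq_of_mem_weightSpace hx hm, b.repr x m, hm, b.repr.injective ?_⟩
  ext m'
  by_cases h : m' = m
  · subst h
    simp
  · have : b.repr x m' = 0 := by
      by_contra h'
      exact h (hb.wt_injective ((hb.wt_eq_of_mem_weightSpace hx h').trans
        (hb.wt_eq_of_mem_weightSpace hx hm).symm))
    simp [this, Finsupp.single_eq_of_ne h]

theorem iterate_mem_weightSpace {D : Derivation K B B} {e : Fin n → ℤ}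
    (hD : ∀ m, ∀ f ∈ weightSpace ρ m, D f ∈ weightSpace ρ (m + e)) {μ : Fin n → ℤ} {x : B}
    (hx : x ∈ weightSpace ρ μ) (k : ℕ) : (D : B → B)^[k] x ∈ weightSpace ρ (μ + k • e) := by
  induction k with
  | zero => simpa using hx
  | succ k ih =>
    rw [Function.iterate_succ_apply', succ_nsmul, ← add_assoc]
    exact hD _ _ ih

omit [AddCommMonoid M] in
theorem apply_eq_sum (D : Derivation K B B) (x : B) (m' : M) :
    b.repr (D x) m' = (b.repr x).sum fun m c => c * b.repr (D (b m)) m' := by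
  conv_lhs => rw [← b.linearCombination_repr x]
  simp [Finsupp.linearCombination_apply, Finsupp.sum, map_sum]

/-- The kernel of a homogeneous derivation is a graded subalgebra. -/
theorem apply_basis_eq_zero [CharZero K] (hb : IsWeightBasis ρ wt b) {D : Derivation K B B}
    (hD : IsHomogeneous ρ D) {x : B} (hx : D x = 0) {m : M} (hm : b.repr x m ≠ 0) :
    D (b m) = 0 := by
  obtain ⟨e, hD⟩ := hD
  by_contra hne
  obtain ⟨m', hm', c, hc, hDm⟩ := hb.exists_eq_smul_basis (hD _ _ (hb.basis_mem_weightSpace m)) hne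
  have h := apply_eq_sum (b := b) D x m'
  rw [hx, Finsupp.sum, Finset.sum_eq_single m] at h
  · simp [hDm, hm, hc] at h
  · intro m₂ _ hm₂
    by_contra h'
    have h2 := hb.wt_eq_of_mem_weightSpace (hD _ _ (hb.basis_mem_weightSpace m₂))
      (right_ne_zero_of_mul h')
    rw [hm'] at h2
    exact hm₂ (hb.wt_injective (add_right_cancel h2)).symm
  · intro h'
    exact absurd (Finsupp.notMem_support_iff.mp h') hm

end IsWeightBasis

end WeightBasis

/-! ### Points of affine varieties -/

section Nullstellensatz

/-- A regular function on an irreducible variety that vanishes on a non-empty open set is zero. -/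
theorem eq_zero_of_forall_mem_of_isOpen {B : Type*} [CommRing B] [IsDomain B]
    [IsJacobsonRing B] {U : Set (MaximalSpectrum B)}
    (hU : IsOpen U) (hne : U.Nonempty) {f : B} (hf : ∀ y ∈ U, f ∈ y.asIdeal) : f = 0 := by
  obtain ⟨x, hx⟩ := hne
  obtain ⟨V, hV, rfl⟩ := isOpen_induced_iff.mp hU
  obtain ⟨_, ⟨g, rfl⟩, hgx, hgV⟩ :=
    PrimeSpectrum.isTopologicalBasis_basic_opens.exists_subset_of_mem_open hx hV
  have hg : g ≠ 0 := by
    rintro rfl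
    exact hgx (Ideal.zero_mem _)
  have hjac : f * g ∈ (⊥ : Ideal B).jacobson := by
    rw [Ideal.jacobson, Ideal.mem_sInf]
    rintro J ⟨-, hJ⟩
    by_cases hgJ : g ∈ J
    · exact J.mul_mem_left f hgJ
    · exact J.mul_mem_right g (hf ⟨J, hJ⟩ (hgV hgJ))
  rw [← Ideal.radical_eq_jacobson, Ideal.isPrime_bot.isRadical.radical] at hjac
  exact (mul_eq_zero.mp (by simpa using hjac)).resolve_right hg

variable {K : Type*} [Field K] [IsAlgClosed K] {B : Type*} [CommRing B] [Algebra K B]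
  [Algebra.FiniteType K B]

/-- The points of an affine variety over an algebraically closed field are rational. -/
theorem exists_algHom_ker_eq (I : Ideal B) [I.IsMaximal] :
    ∃ φ : B →ₐ[K] K, RingHom.ker φ = I := by
  let _ : Field (B ⧸ I) := Ideal.Quotient.field I
  have : Module.Finite K (B ⧸ I) := finite_of_finite_type_of_isJacobsonRing K (B ⧸ I)
  have hbij : Function.Bijective (Algebra.ofId K (B ⧸ I)) :=
    IsAlgClosed.algebraMap_bijective_of_isIntegral
  let ε := AlgEquiv.ofBijective (Algebra.ofId K (B ⧸ I)) hbij
  refine ⟨(ε.symm : B ⧸ I →ₐ[K] K).comp (Ideal.Quotient.mkₐ K I), ?_⟩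
  ext x
  simp [RingHom.mem_ker, Ideal.Quotient.eq_zero_iff_mem]

end Nullstellensatz

/-! ### The weight basis of an affine toric variety -/

section Existence

variable {K : Type*} [Field K] [IsAlgClosed K] [CharZero K] {n : ℕ}
  {B : Type*} [CommRing B] [Algebra K B] {ρ : Torus K n →* (B ≃ₐ[K] B)}

omit [IsAlgClosed K] in
theorem exists_weight_decomposition (hX : IsAffineToric K ρ) (x : B) :
    ∃ c : (Fin n → ℤ) →₀ B, (∀ m, c m ∈ weightSpace ρ m) ∧ x = c.sum fun _ y => y := by
  have := hX.isDomain
  obtain ⟨c, hc⟩ := hX.algebraic x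
  refine ⟨c, fun m s => ?_, by simpa [character_map_one] using hc 1⟩
  have key : c.mapRange (ρ s) (map_zero _) =
      Finsupp.onFinset c.support (fun m => (character m s : K) • c m) (by
        intro m hm
        rw [Finsupp.mem_support_iff]
        intro h
        exact hm (by rw [h, smul_zero])) := by
    refine finsupp_eq_of_character_sum_eq (K := K) fun t => ?_
    rw [Finsupp.sum_mapRange_index (by simp), Finsupp.onFinset_sum _ (by simp)]
    have h := hc (s * t)
    rw [map_mul, AlgEquiv.mul_apply, hc t, map_finsuppSum] at h
    simp only [map_smul, character_map_mul, Units.val_mul] at h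
    rw [h]
    exact Finset.sum_congr rfl fun m _ => by rw [smul_smul, mul_comm]
  exact DFunLike.congr_fun key m

/-- The coordinate ring of an affine toric variety has a basis of semi-invariants normalized to take
the value `1` at a chosen point of the open orbit. -/
theorem exists_isWeightBasis (hX : IsAffineToric K ρ) :
    ∃ (S : AddSubmonoid (Fin n → ℤ)) (b : Basis S K B), IsWeightBasis ρ S.subtype b := by
  have := hX.isDomain
  have := hX.finiteType
  have : IsJacobsonRing B := isJacobsonRing_of_finiteType (A := K)
  obtain ⟨x, hx⟩ := hX.openOrbit
  obtain ⟨φ, hφ⟩ := exists_algHom_ker_eq (K := K) x.asIdeal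
  -- A semi-invariant vanishing at `x` vanishes on the open orbit.
  have hinj : ∀ {m : Fin n → ℤ} {f : B}, f ∈ weightSpace ρ m → φ f = 0 → f = 0 := by
    intro m f hf h0
    refine eq_zero_of_forall_mem_of_isOpen hx
      ⟨x, 1, by rw [map_one]; rfl⟩ ?_
    rintro y ⟨t, ht⟩
    rw [ht, Ideal.mem_comap, ← hφ, RingHom.mem_ker]
    change φ (ρ t f) = 0
    rw [hf t, map_smul, h0, smul_zero]
  let S : AddSubmonoid (Fin n → ℤ) :=
    { carrier := {m | ∃ f ∈ weightSpace ρ m, φ f = 1}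
      zero_mem' := ⟨1, fun t => by simp [character_zero], map_one φ⟩
      add_mem' := by
        rintro m m' ⟨f, hf, h1⟩ ⟨f', hf', h1'⟩
        refine ⟨f * f', fun t => ?_, by rw [map_mul, h1, h1', one_mul]⟩
        rw [map_mul, hf t, hf' t, character_add, Units.val_mul, smul_mul_smul_comm] }
  -- `y m` is the semi-invariant of weight `m` with value `1` at `x`.
  choose y hy hy1 using fun m : S => m.2
  have huniq : ∀ (m : S) (f : B), f ∈ weightSpace ρ (m : Fin n → ℤ) → f = φ f • y m := by
    intro m f hf
    refine sub_eq_zero.mp (hinj (m := m) (sub_mem hf (Submodule.smul_mem _ _ (hy m))) ?_)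
    rw [map_sub, map_smul, hy1, smul_eq_mul, mul_one, sub_self]
  -- Pulling back along the orbit map of `x` turns `y m` into the character of weight `m`.
  let L : B →ₗ[K] (Torus K n → K) := LinearMap.pi fun t => φ.toLinearMap ∘ₗ (ρ t).toLinearMap
  have hli : LinearIndependent K y := by
    refine LinearIndependent.of_comp L ?_
    have h := (linearIndependent_character (K := K) (B := K) (n := n)).comp
      ((↑) : S → (Fin n → ℤ)) Subtype.val_injective
    have hL : L ∘ y = (fun (m : Fin n → ℤ) (t : Torus K n) =>
        algebraMap K K (character m t)) ∘ ((↑) : S → (Fin n → ℤ)) := by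
      funext m t
      have : φ (ρ t (y m)) = (character (m : Fin n → ℤ) t : K) := by
        rw [hy m t, map_smul, hy1, smul_eq_mul, mul_one]
      exact this
    rw [hL]
    exact h
  have hspan : ⊤ ≤ Submodule.span K (Set.range y) := by
    rintro f -
    obtain ⟨c, hc, rfl⟩ := exists_weight_decomposition hX f
    refine Submodule.sum_mem _ fun m _ => ?_
    by_cases h0 : φ (c m) = 0
    · change c m ∈ _
      rw [hinj (hc m) h0]
      exact zero_mem _
    · have hm : m ∈ S := ⟨(φ (c m))⁻¹ • c m, Submodule.smul_mem _ _ (hc m), by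
        rw [map_smul, smul_eq_mul, inv_mul_cancel₀ h0]⟩
      change c m ∈ _
      rw [huniq ⟨m, hm⟩ (c m) (hc m)]
      exact Submodule.smul_mem _ _ (Submodule.subset_span ⟨_, rfl⟩)
  refine ⟨S, Basis.mk hli hspan, ?_⟩
  constructor
  · constructor
    · rw [Basis.mk_apply]
      have := huniq 0 1 (fun t => by simp [character_zero])
      rw [map_one, one_smul] at this
      exact this.symm
    · intro m m'
      simp only [Basis.mk_apply]
      have := huniq (m + m') (y m * y m') (fun t => by
        rw [map_mul, hy m t, hy m' t, AddSubmonoid.coe_add, character_add, Units.val_mul,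
          smul_mul_smul_comm])
      rw [map_mul, hy1, hy1, one_mul, one_smul] at this
      exact this.symm
  · exact Subtype.val_injective
  · intro t m
    rw [Basis.mk_apply]
    exact hy m t

end Existence

/-! ### Extension of characters -/

section Extension

/-- A homomorphism from a submonoid of an abelian group to a divisible group extends to the whole
group. -/
theorem exists_extension_of_divisible {G Q M : Type*} [AddCommGroup G] [AddCommGroup Q]
    [DivisibleBy Q ℤ] [AddCommMonoid M] {i : M →+ G} (hi : Function.Injective i) (χ : M →+ Q) :
    ∃ h : G →+ Q, ∀ m, h (i m) = χ m := by
  let Γ : AddSubgroup G :=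
    { carrier := {z | ∃ a b, z + i b = i a}
      zero_mem' := ⟨0, 0, by simp⟩
      add_mem' := by
        rintro z z' ⟨a, b, h⟩ ⟨a', b', h'⟩
        exact ⟨a + a', b + b', by rw [map_add, map_add, ← h, ← h']; abel⟩
      neg_mem' := by
        rintro z ⟨a, b, h⟩
        exact ⟨b, a, by rw [← h]; abel⟩ }
  choose a b hab using fun z : Γ => z.2
  have hχ : ∀ m₁ m₂ m₃ m₄, i m₁ + i m₂ = i m₃ + i m₄ → χ m₁ + χ m₂ = χ m₃ + χ m₄ := by
    intro m₁ m₂ m₃ m₄ h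
    rw [← map_add, ← map_add] at h
    rw [← map_add, ← map_add, hi h]
  let g : Γ →+ Q := AddMonoidHom.mk' (fun z => χ (a z) - χ (b z)) fun z z' => by
    have h : i (a (z + z')) + i (b z + b z') = i (a z + a z') + i (b (z + z')) := by
      rw [map_add, map_add, ← hab, ← hab, ← hab, AddSubgroup.coe_add]
      abel
    have := hχ _ _ _ _ h
    rw [map_add, map_add] at this
    rw [sub_add_sub_comm, sub_eq_sub_iff_add_eq_add, this]
  obtain ⟨h, hh⟩ := (Module.Baer.of_divisible Q).extension_property_addMonoidHom Γ.subtype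
    Subtype.val_injective g
  refine ⟨h, fun m => ?_⟩
  have hm : i m ∈ Γ := ⟨m, 0, by simp⟩
  have h1 : h (i m) = g ⟨i m, hm⟩ := DFunLike.congr_fun hh ⟨i m, hm⟩
  have h2 := hχ m (b ⟨i m, hm⟩) (a ⟨i m, hm⟩) 0 (by rw [map_zero, add_zero, ← hab])
  rw [map_zero, add_zero] at h2
  rw [h1]
  exact sub_eq_of_eq_add h2.symm

variable {K : Type*} [Field K] {n : ℕ}

theorem exists_character_eq [IsAlgClosed K] {M : Type*} [AddCommMonoid M]
    {wt : M →+ (Fin n → ℤ)} (hwt : Function.Injective wt) (χ : M →+ Additive Kˣ) :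
    ∃ t : Torus K n, ∀ m, character (wt m) t = (χ m).toMul := by
  let _ : DivisibleBy (Additive Kˣ) ℕ := divisibleByOfSMulRightSurj _ _ fun {k} hk x => by
    obtain ⟨z, hz⟩ := IsAlgClosed.exists_pow_nat_eq (x.toMul : K) (Nat.pos_of_ne_zero hk)
    have hz0 : z ≠ 0 := by
      rintro rfl
      rw [zero_pow hk] at hz
      exact x.toMul.ne_zero hz.symm
    exact ⟨Additive.ofMul (Units.mk0 z hz0),
      Additive.toMul.injective (Units.ext (by simpa using hz))⟩
  let _ : DivisibleBy (Additive Kˣ) ℤ := AddGroup.divisibleByIntOfDivisibleByNat _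
  obtain ⟨h, hh⟩ := exists_extension_of_divisible hwt χ
  refine ⟨fun i => (h (Pi.single i 1)).toMul, fun m => ?_⟩
  rw [← hh m]
  conv_rhs => rw [← Finset.univ_sum_single (wt m), map_sum, toMul_sum]
  refine Finset.prod_congr rfl fun i _ => ?_
  rw [← toMul_zsmul, ← map_zsmul, ← Pi.single_smul, smul_eq_mul, mul_one]

end Extension

/-! ### The open orbit -/

section OpenOrbit

variable {K : Type*} [Field K] {B : Type*} [CommRing B] [Algebra K B]

theorem IsMultiplicativeBasis.exists_finset_closure_eq_top [Algebra.FiniteType K B] {M : Type*}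
    [AddCommMonoid M] {b : Basis M K B} (hb : IsMultiplicativeBasis b) :
    ∃ E : Finset M, AddSubmonoid.closure (E : Set M) = ⊤ := by
  classical
  obtain ⟨G, hG⟩ := (inferInstance : Algebra.FiniteType K B).out
  let E := G.biUnion fun g => (b.repr g).support
  refine ⟨E, top_unique fun m _ => ?_⟩
  have hGE : (G : Set B) ⊆ Algebra.adjoin K (b '' E) := by
    intro g hg
    refine Algebra.span_le_adjoin K _ (b.mem_span_image.mpr ?_)
    exact fun m hm => Finset.mem_biUnion.mpr ⟨g, hg, hm⟩
  have htop : Algebra.adjoin K (b '' (E : Set M)) = ⊤ :=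
    top_unique (hG ▸ Algebra.adjoin_le hGE)
  have hle : (Submonoid.closure (b '' (E : Set M)) : Set B) ⊆
      b '' (AddSubmonoid.closure (E : Set M)) := by
    intro x hx
    induction hx using Submonoid.closure_induction with
    | mem x hx => exact Set.image_mono AddSubmonoid.subset_closure hx
    | one => exact ⟨0, zero_mem _, hb.map_zero⟩
    | mul x y _ _ hx hy =>
      obtain ⟨m, hm, rfl⟩ := hx
      obtain ⟨m', hm', rfl⟩ := hy
      exact ⟨m + m', add_mem hm hm', hb.map_add m m'⟩
  have hm : b m ∈ Submodule.span K (Submonoid.closure (b '' (E : Set M)) : Set B) := by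
    rw [← Algebra.adjoin_eq_span, htop]
    trivial
  have hm' := b.mem_span_image.mp (Submodule.span_mono hle hm)
  exact hm' (by simp)

/-- The torus orbit of the point where all basis semi-invariants take the value `1` is open: it is
the locus where no generator of the weight monoid vanishes. -/
theorem IsWeightBasis.exists_isOpen_orbit [IsAlgClosed K] [Algebra.FiniteType K B] {n : ℕ}
    {ρ : Torus K n →* (B ≃ₐ[K] B)} {M : Type*} [AddCommMonoid M] {wt : M →+ (Fin n → ℤ)}
    {b : Basis M K B} (hb : IsWeightBasis ρ wt b) : ∃ x : MaximalSpectrum B,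
    IsOpen {y : MaximalSpectrum B | ∃ t : Torus K n, y.asIdeal = x.asIdeal.comap (ρ t)} := by
  obtain ⟨E, hE⟩ := hb.toIsMultiplicativeBasis.exists_finset_closure_eq_top
  let φ : B →ₐ[K] K := hb.algHom (fun _ => 1) rfl fun _ _ => (one_mul 1).symm
  have hφ : ∀ t m, φ (ρ t (b m)) = (character (wt m) t : K) := by
    intro t m
    rw [hb.apply_basis, map_smul, hb.algHom_apply, smul_eq_mul, mul_one]
  have hφs : Function.Surjective φ := fun c => ⟨algebraMap K B c, φ.commutes c⟩
  refine ⟨⟨RingHom.ker φ, RingHom.ker_isMaximal_of_surjective φ hφs⟩, ?_⟩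
  refine isOpen_induced_iff.mpr ⟨PrimeSpectrum.basicOpen (∏ m ∈ E, b m),
    PrimeSpectrum.isOpen_basicOpen, ?_⟩
  ext y
  change (∏ m ∈ E, b m) ∉ y.asIdeal ↔ ∃ t, y.asIdeal = (RingHom.ker φ).comap (ρ t)
  constructor
  · intro hy
    obtain ⟨ψ, hψ⟩ := exists_algHom_ker_eq (K := K) y.asIdeal
    rw [← hψ, RingHom.mem_ker, map_prod, Finset.prod_eq_zero_iff] at hy
    push Not at hy
    have hne : ∀ m, ψ (b m) ≠ 0 := by
      intro m
      have hm : m ∈ AddSubmonoid.closure (E : Set M) := hE ▸ AddSubmonoid.mem_top m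
      induction hm using AddSubmonoid.closure_induction with
      | mem m hm => exact hy m hm
      | zero => rw [hb.map_zero, map_one]; exact one_ne_zero
      | add m m' _ _ h h' => rw [hb.map_add, map_mul]; exact mul_ne_zero h h'
    let χ : M →+ Additive Kˣ :=
      { toFun := fun m => Additive.ofMul (Units.mk0 (ψ (b m)) (hne m))
        map_zero' := Additive.toMul.injective (Units.ext (by simp [hb.map_zero]))
        map_add' := fun m m' =>
          Additive.toMul.injective (Units.ext (by simp [hb.map_add])) }
    obtain ⟨t, ht⟩ := exists_character_eq hb.wt_injective χ
    refine ⟨t, ?_⟩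
    have hψφ : ψ.toLinearMap = φ.toLinearMap ∘ₗ (ρ t).toLinearMap :=
      b.ext fun m => ((hφ t m).trans (congrArg Units.val (ht m))).symm
    ext f
    rw [← hψ, RingHom.mem_ker, Ideal.mem_comap, RingHom.mem_ker]
    exact Eq.congr_left (LinearMap.congr_fun hψφ f)
  · rintro ⟨t, ht⟩ hy
    rw [ht, Ideal.mem_comap, RingHom.mem_ker, map_prod, map_prod, Finset.prod_eq_zero_iff] at hy
    obtain ⟨m, -, hm⟩ := hy
    exact (character (wt m) t).ne_zero ((hφ t m).symm.trans hm)

end OpenOrbit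

/-! ### Homogeneous slices -/

section Slice

variable {K : Type*} [Field K] [CharZero K] {n : ℕ} {B : Type*} [CommRing B] [IsDomain B]
  [Algebra K B] {ρ : Torus K n →* (B ≃ₐ[K] B)} {M : Type*} [AddCommMonoid M]
  {wt : M →+ (Fin n → ℤ)} {b : Basis M K B}

omit [IsDomain B] in
/-- A homogeneous derivation with a slice has a slice which is a scalar multiple of a basis
semi-invariant. -/
theorem IsWeightBasis.exists_basis_slice (hb : IsWeightBasis ρ wt b) {D : Derivation K B B}
    {e : Fin n → ℤ} (hD : ∀ m, ∀ f ∈ weightSpace ρ m, D f ∈ weightSpace ρ (m + e)) [Nontrivial B]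
    {s : B} (hs : D s = 1) : ∃ u, wt u + e = 0 ∧ ∃ c : K, c ≠ 0 ∧ D (b u) = c • 1 := by
  have h := apply_eq_sum (b := b) D s 0
  rw [hs, ← hb.map_zero, b.repr_self, Finsupp.single_eq_same] at h
  obtain ⟨u, -, hu⟩ := Finset.exists_ne_zero_of_sum_ne_zero (h ▸ one_ne_zero)
  have hu' := right_ne_zero_of_mul hu
  have hmem := hD _ _ (hb.basis_mem_weightSpace u)
  have hne : D (b u) ≠ 0 := fun h0 => hu' (by simp [h0])
  have hwt := hb.wt_eq_of_mem_weightSpace hmem hu'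
  obtain ⟨m, hm, c, hc, hDu⟩ := hb.exists_eq_smul_basis hmem hne
  obtain rfl : m = 0 := hb.wt_injective (hm.trans hwt.symm)
  exact ⟨u, by rw [← hwt, map_zero], c, hc, by rw [hDu, hb.map_zero]⟩

/-- The slice theorem for weights: the weight `u` of a homogeneous slice splits off from the weight
monoid as a free summand `ℕ u`, the complement consisting of the weights in the kernel of `D`. -/
theorem IsWeightBasis.exists_slice_splitting (hb : IsWeightBasis ρ wt b) {D : Derivation K B B}
    (hDh : D ∈ LNDh ρ) (hDs : D ∈ LNDStar K B) :
    ∃ (u : M) (l : M →+ ℕ) (r : M →+ M), (∀ m, r m + l m • u = m) ∧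
      (∀ m, l (r m) = 0) ∧ ∀ m, D (b m) = 0 ↔ l m = 0 := by
  obtain ⟨hL, e, hD⟩ := hDh
  obtain ⟨-, s, hs⟩ := hDs
  obtain ⟨u, hu, c, hc, hDu⟩ := hb.exists_basis_slice hD hs
  have hDu0 : D (b u) ≠ 0 := by
    rw [hDu]
    exact smul_ne_zero hc one_ne_zero
  have hex : ∀ m, ∃ (a : M) (k : ℕ), a + k • u = m ∧ D (b a) = 0 := by
    intro m
    -- The last nonzero iterate `D^k (b m)` is homogeneous, of the weight `m - k u`.
    obtain ⟨k, hk, hk'⟩ := exists_last_iterate hL (b.ne_zero m)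
    obtain ⟨a, ha, c', hc', hDk⟩ := hb.exists_eq_smul_basis
      (IsWeightBasis.iterate_mem_weightSpace hD (hb.basis_mem_weightSpace m) k) hk
    refine ⟨a, k, hb.wt_injective ?_, ?_⟩
    · rw [map_add, map_nsmul, ha, add_assoc, ← nsmul_add, add_comm e, hu, nsmul_zero, add_zero]
    · rw [Function.iterate_succ_apply', hDk, D.map_smul] at hk'
      exact (smul_eq_zero.mp hk').resolve_left hc'
  have hle : ∀ {a a' : M} {k k' : ℕ}, a + k • u = a' + k' • u → D (b a) = 0 → k' ≤ k := by
    intro a a' k k' h ha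
    by_contra! hlt
    obtain ⟨j, rfl⟩ := Nat.exists_eq_add_of_lt hlt
    have h' : a = u + (a' + j • u) := by
      refine hb.add_left_cancel' (m := k • u) ?_
      rw [add_comm, h, add_nsmul, add_nsmul, one_nsmul]
      abel
    rw [h', hb.map_add] at ha
    exact hDu0 (apply_eq_zero_of_mul hL (b.ne_zero _) ha)
  have huniq : ∀ {a a' : M} {k k' : ℕ}, a + k • u = a' + k' • u → D (b a) = 0 → D (b a') = 0 →
      a = a' ∧ k = k' := by
    intro a a' k k' h ha ha'
    obtain rfl := le_antisymm (hle h.symm ha') (hle h ha)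
    refine ⟨hb.add_left_cancel' (m := k • u) ?_, rfl⟩
    rw [add_comm, h, add_comm]
  have hadd : ∀ {a a' : M}, D (b a) = 0 → D (b a') = 0 → D (b (a + a')) = 0 := by
    intro a a' ha ha'
    rw [hb.map_add, D.leibniz, ha, ha', smul_zero, smul_zero, add_zero]
  have hD0 : D (b 0) = 0 := by rw [hb.map_zero, D.map_one_eq_zero]
  choose r l hrl hDr using hex
  have h0 := huniq (a' := 0) (k' := 0) (by rw [hrl, zero_nsmul, add_zero]) (hDr 0) hD0
  have hrladd : ∀ m m', r (m + m') = r m + r m' ∧ l (m + m') = l m + l m' := fun m m' =>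
    huniq (by rw [hrl, add_nsmul, add_add_add_comm, hrl, hrl]) (hDr _) (hadd (hDr m) (hDr m'))
  have hl : ∀ m, D (b m) = 0 → l m = 0 := fun m h =>
    (huniq (a' := m) (k' := 0) (by rw [hrl, zero_nsmul, add_zero]) (hDr m) h).2
  refine ⟨u, ⟨⟨l, h0.2⟩, fun m m' => (hrladd m m').2⟩, ⟨⟨r, h0.1⟩, fun m m' => (hrladd m m').1⟩,
    hrl, fun m => hl _ (hDr m), fun m => ⟨hl m, fun h => ?_⟩⟩
  have hr := hrl m
  rw [show l m = 0 from h, zero_nsmul, add_zero] at hr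
  rw [← hr]
  exact hDr m

end Slice

/-! ### Splitting off free summands of a monoid -/

section Retraction

variable {M G : Type*} [AddCommMonoid M] [AddCommGroup G]

/-- The kernel of an endomorphism `p` of a submonoid `M` of a group `G`, extended to the subgroup
generated by `M`: the differences of elements identified by `p`. -/
def groupKernel (i : M →+ G) (p : M →+ M) : AddSubgroup G where
  carrier := {z | ∃ a b, p a = p b ∧ z + i b = i a}
  zero_mem' := ⟨0, 0, rfl, by simp⟩
  add_mem' := by
    rintro z z' ⟨a, b, hp, h⟩ ⟨a', b', hp', h'⟩
    exact ⟨a + a', b + b', by rw [map_add, map_add, hp, hp'],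
      by rw [map_add, map_add, ← h, ← h']; abel⟩
  neg_mem' := by
    rintro z ⟨a, b, hp, h⟩
    exact ⟨b, a, hp.symm, by rw [← h]; abel⟩

/-- If each functional `l` of a family splits off a free summand `ℕ u` from a submonoid `M` of a
finitely generated abelian group, then the common zero set `F` of the family splits off from `M` as
well: there is a retraction `p` of `M` onto `F` such that `m - p m` lies in `M` for all `m`.

As long as some `l` is nonzero on the image of `p`, replacing `p` by `p ∘ r ∘ p` enlarges the kernel
of `p`, and this stops because the group is Noetherian. -/
theorem exists_retraction [IsNoetherian ℤ G] {i : M →+ G} (hi : Function.Injective i)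
    (𝓛 : Set (M →+ ℕ)) (h𝓛 : ∀ l ∈ 𝓛, ∃ (u : M) (r : M →+ M),
      (∀ m, r m + l m • u = m) ∧ ∀ m, l (r m) = 0) :
    ∃ p q : M →+ M, (∀ m, p m + q m = m) ∧ (∀ l ∈ 𝓛, ∀ m, l (p m) = 0) ∧
      ∀ m, (∀ l ∈ 𝓛, l m = 0) → p m = m := by
  let P : Set ((M →+ M) × (M →+ M)) := {x | (∀ m, x.1 m + x.2 m = m) ∧
    (∀ m, x.1 (x.1 m) = x.1 m) ∧ ∀ m, (∀ l ∈ 𝓛, l m = 0) → x.1 m = m}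
  have hP : P.Nonempty := ⟨(AddMonoidHom.id M, 0), by simp [P]⟩
  obtain ⟨⟨p, q⟩, ⟨hpq, hpp, hfix⟩, hmax⟩ :=
    (InvImage.wf (fun x : (M →+ M) × (M →+ M) => (groupKernel i x.1).toIntSubmodule)
      (wellFounded_gt (α := Submodule ℤ G))).has_min P hP
  dsimp only at hpq hpp hfix
  refine ⟨p, q, hpq, fun l hl g => ?_, hfix⟩
  by_contra hne
  obtain ⟨u, r, hru, hlr⟩ := h𝓛 l hl
  have hr : ∀ m, l m = 0 → r m = m := fun m hm => by
    have := hru m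
    rwa [hm, zero_nsmul, add_zero] at this
  have hlp : ∀ m, l m = 0 → l (p m) = 0 := fun m hm => by
    have := congrArg l (hpq m)
    rw [map_add, hm] at this
    omega
  let p' : M →+ M := p.comp (r.comp p)
  have hp' : ∀ m, p' m = p (r (p m)) := fun _ => rfl
  let q' : M →+ M := q + ((AddMonoidHom.flip (smulAddHom ℕ M)) (p u)).comp (l.comp p)
  have hq' : ∀ m, q' m = q m + l (p m) • p u := fun _ => rfl
  have hlp' : ∀ m, l (p' m) = 0 := fun m => hlp _ (hlr _)
  have hpp' : ∀ m, p (p' m) = p' m := fun m => hpp _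
  have hp'p' : ∀ m, p' (p' m) = p' m := fun m => by
    rw [hp' (p' m), hpp', hr _ (hlp' m), hpp']
  have hmem : (p', q') ∈ P := by
    refine ⟨fun m => ?_, hp'p', fun m hm => ?_⟩
    · have h1 : p' m + l (p m) • p u = p m := by
        rw [hp', ← map_nsmul, ← map_add, hru, hpp]
      change p' m + q' m = m
      rw [hq', add_left_comm, h1, add_comm, hpq]
    · change p' m = m
      rw [hp', hfix m hm, hr m (hm l hl), hfix m hm]
  refine hmax _ hmem (lt_of_le_not_ge ?_ fun hle => ?_)
  · rintro z ⟨a, b, hab, hz⟩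
    exact ⟨a, b, by rw [hp', hp', hab], hz⟩
  · have hz : i (p g) - i (p' (p g)) ∈ groupKernel i p' :=
      ⟨p g, p' (p g), (hp'p' _).symm, sub_add_cancel _ _⟩
    obtain ⟨a, b, hab, hz⟩ := hle hz
    have h1 : p g + b = a + p' (p g) := hi (by
      rw [map_add, map_add, ← hz]
      abel)
    have h2 := congrArg p h1
    rw [map_add, map_add, hpp, hpp', show p a = p b from hab, add_comm] at h2
    have h3 : p g = p' (p g) := by
      refine hi (add_left_cancel (a := i (p b)) ?_)
      rw [← map_add i, ← map_add i, h2]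
    exact hne (by rw [h3]; exact hlp' _)

end Retraction

/-! ### The weights of `ML^*_h` -/

section MakarLimanov

variable {K : Type*} [Field K] [CharZero K] {n : ℕ} {B : Type*} [CommRing B] [IsDomain B]
  [Algebra K B] {ρ : Torus K n →* (B ≃ₐ[K] B)} {M : Type*} [AddCommMonoid M]
  {wt : M →+ (Fin n → ℤ)} {b : Basis M K B}

theorem IsWeightBasis.exists_retraction_MLhStar (hb : IsWeightBasis ρ wt b) :
    ∃ p q : M →+ M, (∀ m, p m + q m = m) ∧ (∀ m, b (p m) ∈ MLhStar ρ) ∧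
      ∀ m, b m ∈ MLhStar ρ → p m = m := by
  obtain ⟨p, q, hpq, hlp, hfix⟩ := exists_retraction hb.wt_injective
    {l : M →+ ℕ | ∃ D ∈ LNDh ρ ∩ LNDStar K B, (∀ m, D (b m) = 0 ↔ l m = 0) ∧
      ∃ (u : M) (r : M →+ M), (∀ m, r m + l m • u = m) ∧ ∀ m, l (r m) = 0}
    fun l ⟨_, _, _, h⟩ => h
  refine ⟨p, q, hpq, fun m D hD => ?_, fun m hm => hfix m ?_⟩
  · obtain ⟨u, l, r, hru, hlr, hDl⟩ := hb.exists_slice_splitting hD.1 hD.2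
    exact (hDl _).mpr (hlp l ⟨D, hD, hDl, u, r, hru, hlr⟩ m)
  · rintro l ⟨D, hD, hDl, -⟩
    exact (hDl m).mp (hm D hD)

end MakarLimanov

/-! ### Stable subalgebras -/

section Restriction

variable {K : Type*} [Field K] {n : ℕ} {B : Type*} [CommRing B] [Algebra K B]

/-- The restriction of a torus action to a stable subalgebra. -/
def restrictAction (ρ : Torus K n →* (B ≃ₐ[K] B)) (A : Subalgebra K B)
    (hA : ∀ t, ∀ x ∈ A, ρ t x ∈ A) : Torus K n →* (A ≃ₐ[K] A) where
  toFun t := AlgEquiv.ofAlgHom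
    (((ρ t : B →ₐ[K] B).comp A.val).codRestrict A fun x => hA t x x.2)
    (((ρ t⁻¹ : B →ₐ[K] B).comp A.val).codRestrict A fun x => hA t⁻¹ x x.2)
    (AlgHom.ext fun x => Subtype.ext (by
      change ρ t (ρ t⁻¹ (x : B)) = x
      rw [← AlgEquiv.mul_apply, ← map_mul, mul_inv_cancel, map_one, AlgEquiv.one_apply]))
    (AlgHom.ext fun x => Subtype.ext (by
      change ρ t⁻¹ (ρ t (x : B)) = x
      rw [← AlgEquiv.mul_apply, ← map_mul, inv_mul_cancel, map_one, AlgEquiv.one_apply]))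
  map_one' := AlgEquiv.ext fun x => Subtype.ext (by
    change ρ 1 (x : B) = x
    rw [map_one, AlgEquiv.one_apply])
  map_mul' s t := AlgEquiv.ext fun x => Subtype.ext (by
    change ρ (s * t) (x : B) = ρ s (ρ t (x : B))
    rw [map_mul, AlgEquiv.mul_apply])

theorem coe_restrictAction (ρ : Torus K n →* (B ≃ₐ[K] B)) (A : Subalgebra K B)
    (hA : ∀ t, ∀ x ∈ A, ρ t x ∈ A) (t : Torus K n) (x : A) :
    (restrictAction ρ A hA t x : B) = ρ t (x : B) := rfl

end Restriction

/-! ### Face subalgebras -/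

section Face

variable {K : Type*} [Field K] {n : ℕ} {B : Type*} [CommRing B] [Algebra K B]
  {ρ : Torus K n →* (B ≃ₐ[K] B)} {M : Type*} [AddCommMonoid M] {wt : M →+ (Fin n → ℤ)}
  {b : Basis M K B}

/-- `A` is spanned by the basis elements whose index lies in a face of the monoid `M`, that is, a
submonoid containing `m` and `m'` whenever it contains `m + m'`. -/
structure IsFaceSubalgebra (b : Basis M K B) (A : Subalgebra K B) : Prop where
  basis_mem : ∀ x ∈ A, ∀ m, b.repr x m ≠ 0 → b m ∈ A
  mem_of_add : ∀ m m', b (m + m') ∈ A → b m ∈ A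

/-- The submonoid of the indices of the basis elements that lie in `A`. -/
def IsMultiplicativeBasis.submonoid (hb : IsMultiplicativeBasis b) (A : Subalgebra K B) :
    AddSubmonoid M where
  carrier := {m | b m ∈ A}
  zero_mem' := by
    change b 0 ∈ A
    rw [hb.map_zero]
    exact one_mem A
  add_mem' {m m'} hm hm' := by
    change b (m + m') ∈ A
    rw [hb.map_add]
    exact mul_mem hm hm'

namespace IsFaceSubalgebra

variable {A : Subalgebra K B}

theorem mem_iff (hA : IsFaceSubalgebra b A) {x : B} :
    x ∈ A ↔ ∀ m, b.repr x m ≠ 0 → b m ∈ A := by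
  refine ⟨hA.basis_mem x, fun h => ?_⟩
  rw [← b.linearCombination_repr x]
  exact sum_mem fun m hm => A.smul_mem (h m (Finsupp.mem_support_iff.mp hm)) _

/-- The basis of a face subalgebra consisting of the basis elements contained in it. -/
noncomputable def basis (hA : IsFaceSubalgebra b A) (hb : IsMultiplicativeBasis b) :
    Basis (hb.submonoid A) K A :=
  Basis.mk (v := fun m : hb.submonoid A => (⟨b m, m.2⟩ : A))
    (LinearIndependent.of_comp A.val.toLinearMap
      (b.linearIndependent.comp ((↑) : hb.submonoid A → M) Subtype.val_injective)) (by
    rintro x -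
    have hx : x = ∑ m ∈ (b.repr (x : B)).support.attach, b.repr (x : B) m.1 •
        (⟨b m.1, hA.basis_mem x x.2 m (Finsupp.mem_support_iff.mp m.2)⟩ : A) := by
      refine Subtype.ext ?_
      rw [AddSubmonoidClass.coe_finsetSum]
      conv_lhs => rw [← b.linearCombination_repr (x : B)]
      exact (Finset.sum_attach _ (fun m => b.repr (x : B) m • b m)).symm
    rw [hx]
    exact Submodule.sum_mem _ fun m _ => Submodule.smul_mem _ _ (Submodule.subset_span
      ⟨⟨m.1, hA.basis_mem x x.2 m (Finsupp.mem_support_iff.mp m.2)⟩, rfl⟩))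

theorem coe_basis (hA : IsFaceSubalgebra b A) (hb : IsMultiplicativeBasis b)
    (m : hb.submonoid A) : (hA.basis hb m : B) = b m := by
  rw [basis, Basis.mk_apply]

theorem apply_mem [CharZero K] (hA : IsFaceSubalgebra b A) (hb : IsWeightBasis ρ wt b) :
    ∀ t, ∀ x ∈ A, ρ t x ∈ A := by
  intro t x hx
  rw [hA.mem_iff]
  intro m hm
  rw [hb.repr_apply] at hm
  exact hA.basis_mem x hx m (right_ne_zero_of_mul hm)

theorem isWeightBasis [CharZero K] (hA : IsFaceSubalgebra b A) (hb : IsWeightBasis ρ wt b) :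
    IsWeightBasis (restrictAction ρ A (hA.apply_mem hb))
      (wt.comp (hb.toIsMultiplicativeBasis.submonoid A).subtype)
      (hA.basis hb.toIsMultiplicativeBasis) where
  map_zero := Subtype.ext (by rw [coe_basis]; exact hb.map_zero)
  map_add m m' := Subtype.ext (by
    rw [coe_basis, MulMemClass.coe_mul, coe_basis, coe_basis]
    exact hb.map_add m m')
  wt_injective := hb.wt_injective.comp Subtype.val_injective
  apply_basis t m := Subtype.ext (by
    rw [coe_restrictAction, SetLike.val_smul, coe_basis]
    exact hb.apply_basis t m)

open Classical in
/-- The retraction of `B` onto a face subalgebra that annihilates all other basis elements. -/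
noncomputable def proj (hA : IsFaceSubalgebra b A) (hb : IsMultiplicativeBasis b) : B →ₐ[K] A :=
  hb.algHom (fun m => if h : b m ∈ A then ⟨b m, h⟩ else 0)
    (by
      have h : b 0 ∈ A := by
        rw [hb.map_zero]
        exact one_mem A
      rw [dif_pos h]
      exact Subtype.ext hb.map_zero)
    (fun m m' => by
      by_cases h : b (m + m') ∈ A
      · have hm := hA.mem_of_add m m' h
        have hm' := hA.mem_of_add m' m (add_comm m m' ▸ h)
        rw [dif_pos h, dif_pos hm, dif_pos hm']
        exact Subtype.ext (hb.map_add m m')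
      · rw [dif_neg h]
        by_cases hm : b m ∈ A
        · have hm' : b m' ∉ A := fun hm' => h (hb.map_add m m' ▸ mul_mem hm hm')
          rw [dif_neg hm', mul_zero]
        · rw [dif_neg hm, zero_mul])

theorem proj_of_mem (hA : IsFaceSubalgebra b A) (hb : IsMultiplicativeBasis b) {m : M}
    (h : b m ∈ A) : hA.proj hb (b m) = ⟨b m, h⟩ := by
  rw [proj, hb.algHom_apply, dif_pos h]

theorem proj_of_notMem (hA : IsFaceSubalgebra b A) (hb : IsMultiplicativeBasis b) {m : M}
    (h : b m ∉ A) : hA.proj hb (b m) = 0 := by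
  rw [proj, hb.algHom_apply, dif_neg h]

theorem proj_coe (hA : IsFaceSubalgebra b A) (hb : IsMultiplicativeBasis b) (x : A) :
    hA.proj hb x = x := by
  have : (hA.proj hb).toLinearMap ∘ₗ A.val.toLinearMap = LinearMap.id := by
    refine (hA.basis hb).ext fun m => ?_
    change hA.proj hb (hA.basis hb m : B) = hA.basis hb m
    rw [coe_basis, hA.proj_of_mem hb m.2]
    exact Subtype.ext (hA.coe_basis hb m).symm
  exact LinearMap.congr_fun this x

theorem proj_apply [CharZero K] (hA : IsFaceSubalgebra b A) (hb : IsWeightBasis ρ wt b)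
    (t : Torus K n) (x : B) : hA.proj hb.toIsMultiplicativeBasis (ρ t x) =
      restrictAction ρ A (hA.apply_mem hb) t (hA.proj hb.toIsMultiplicativeBasis x) := by
  have : (hA.proj hb.toIsMultiplicativeBasis).toLinearMap ∘ₗ (ρ t).toLinearMap =
      (restrictAction ρ A (hA.apply_mem hb) t).toLinearMap ∘ₗ
        (hA.proj hb.toIsMultiplicativeBasis).toLinearMap := by
    refine b.ext fun m => ?_
    change hA.proj hb.toIsMultiplicativeBasis (ρ t (b m)) =
      restrictAction ρ A (hA.apply_mem hb) t (hA.proj hb.toIsMultiplicativeBasis (b m))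
    rw [hb.apply_basis, map_smul]
    by_cases h : b m ∈ A
    · rw [hA.proj_of_mem _ h]
      exact Subtype.ext (hb.apply_basis t m).symm
    · rw [hA.proj_of_notMem _ h, smul_zero, map_zero]
  exact LinearMap.congr_fun this x

/-- A face subalgebra of the coordinate ring of an affine toric variety is the coordinate ring of an
affine toric variety. -/
theorem isAffineToric [IsAlgClosed K] [CharZero K] (hX : IsAffineToric K ρ)
    (hA : IsFaceSubalgebra b A) (hb : IsWeightBasis ρ wt b) :
    IsAffineToric K (restrictAction ρ A (hA.apply_mem hb)) := by
  have := hX.isDomain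
  have := hX.finiteType
  have hfin : Algebra.FiniteType K A := Algebra.FiniteType.of_surjective
    (hA.proj hb.toIsMultiplicativeBasis) fun x => ⟨x, hA.proj_coe _ x⟩
  refine ⟨hfin, inferInstance, fun x => ?_, (hA.isWeightBasis hb).exists_isOpen_orbit⟩
  obtain ⟨c, hc⟩ := hX.algebraic x
  refine ⟨c.mapRange (hA.proj hb.toIsMultiplicativeBasis) (map_zero _), fun t => ?_⟩
  rw [Finsupp.sum_mapRange_index (by simp)]
  conv_lhs => rw [← hA.proj_coe hb.toIsMultiplicativeBasis x, ← hA.proj_apply hb, hc,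
    map_finsuppSum]
  simp only [map_smul]

end IsFaceSubalgebra

/-- The common kernel of homogeneous locally nilpotent derivations is a face subalgebra. -/
theorem IsWeightBasis.isFaceSubalgebra_kernels [CharZero K] [IsDomain B]
    (hb : IsWeightBasis ρ wt b) {𝒟 : Set (Derivation K B B)} (h𝒟 : 𝒟 ⊆ LNDh ρ) :
    IsFaceSubalgebra b (kernels 𝒟) where
  basis_mem _ hx _ hm D hD := hb.apply_basis_eq_zero (h𝒟 hD).2 (hx D hD) hm
  mem_of_add m m' h D hD := by
    have := h D hD
    rw [hb.map_add] at this
    exact apply_eq_zero_of_mul (h𝒟 hD).1 (b.ne_zero m') this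

end Face

/-! ### Homogeneous components of derivations -/

section Components

variable {K : Type*} [Field K] {n : ℕ} {B : Type*} [CommRing B] [Algebra K B]
  {ρ : Torus K n →* (B ≃ₐ[K] B)} {M : Type*} [AddCommMonoid M] {wt : M →+ (Fin n → ℤ)}
  {b : Basis M K B}

/-- The projection of `B` onto the homogeneous component of degree `μ`. -/
noncomputable def homogeneousPart (b : Basis M K B) (wt : M →+ (Fin n → ℤ)) (μ : Fin n → ℤ) :
    B →ₗ[K] B :=
  b.constr K fun m => if wt m = μ then b m else 0

theorem homogeneousPart_basis (μ : Fin n → ℤ) (m : M) :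
    homogeneousPart b wt μ (b m) = if wt m = μ then b m else 0 :=
  b.constr_basis K _ m

theorem repr_homogeneousPart (μ : Fin n → ℤ) (x : B) (m : M) :
    b.repr (homogeneousPart b wt μ x) m = if wt m = μ then b.repr x m else 0 := by
  have : b.coord m ∘ₗ homogeneousPart b wt μ = if wt m = μ then b.coord m else 0 := by
    refine b.ext fun m' => ?_
    rw [LinearMap.comp_apply, homogeneousPart_basis]
    by_cases hm : m' = m
    · subst hm
      split_ifs <;> simp
    · split_ifs <;> simp [Finsupp.single_eq_of_ne' hm]
  have h := LinearMap.congr_fun this x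
  split_ifs at h ⊢ <;> exact h

theorem IsWeightBasis.homogeneousPart_mem [CharZero K] (hb : IsWeightBasis ρ wt b)
    (μ : Fin n → ℤ) (x : B) : homogeneousPart b wt μ x ∈ weightSpace ρ μ := by
  rw [hb.mem_weightSpace_iff]
  intro m hm
  rw [repr_homogeneousPart] at hm
  by_contra h
  exact hm (if_neg h)

theorem IsMultiplicativeBasis.homogeneousPart_mul (hb : IsMultiplicativeBasis b)
    (μ : Fin n → ℤ) (m : M) (x : B) :
    homogeneousPart b wt (wt m + μ) (b m * x) = b m * homogeneousPart b wt μ x := by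
  have : homogeneousPart b wt (wt m + μ) ∘ₗ LinearMap.mulLeft K (b m) =
      LinearMap.mulLeft K (b m) ∘ₗ homogeneousPart b wt μ := by
    refine b.ext fun m' => ?_
    simp only [LinearMap.comp_apply, LinearMap.mulLeft_apply, ← hb.map_add, homogeneousPart_basis,
      _root_.map_add, add_right_inj]
    split_ifs
    · exact hb.map_add m m'
    · rw [mul_zero]
  exact LinearMap.congr_fun this x

/-- The homogeneous component of degree `e` of a derivation. -/
noncomputable def IsMultiplicativeBasis.component (hb : IsMultiplicativeBasis b)
    (wt : M →+ (Fin n → ℤ)) (D : Derivation K B B) (e : Fin n → ℤ) : Derivation K B B :=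
  hb.derivation (fun m => homogeneousPart b wt (wt m + e) (D (b m))) fun m m' => by
    rw [hb.map_add, D.leibniz, _root_.map_add wt, _root_.map_add, smul_eq_mul, smul_eq_mul, add_assoc,
      hb.homogeneousPart_mul, add_left_comm, hb.homogeneousPart_mul]

theorem IsMultiplicativeBasis.component_basis (hb : IsMultiplicativeBasis b)
    (D : Derivation K B B) (e : Fin n → ℤ) (m : M) :
    hb.component wt D e (b m) = homogeneousPart b wt (wt m + e) (D (b m)) :=
  hb.derivation_apply _ _ m

theorem IsWeightBasis.isHomogeneous_component [CharZero K] (hb : IsWeightBasis ρ wt b)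
    (D : Derivation K B B) (e : Fin n → ℤ) :
    IsHomogeneous ρ (hb.toIsMultiplicativeBasis.component wt D e) := by
  refine ⟨e, fun μ f hf => ?_⟩
  by_cases h0 : f = 0
  · rw [h0, map_zero]
    exact zero_mem _
  obtain ⟨m, rfl, c, -, rfl⟩ := hb.exists_eq_smul_basis hf h0
  rw [Derivation.map_smul, hb.component_basis]
  exact Submodule.smul_mem _ _ (hb.homogeneousPart_mem _ _)

theorem IsMultiplicativeBasis.component_sub_ne_zero (hb : IsMultiplicativeBasis b)
    {D : Derivation K B B} {m m' : M} (h : b.repr (D (b m)) m' ≠ 0) :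
    hb.component wt D (wt m' - wt m) ≠ 0 := by
  intro h0
  have h1 := hb.component_basis (wt := wt) D (wt m' - wt m) m
  rw [h0, add_sub_cancel, Derivation.zero_apply] at h1
  have h2 := repr_homogeneousPart (b := b) (wt := wt) (wt m') (D (b m)) m'
  rw [← h1, if_pos rfl] at h2
  exact h (h2.symm.trans (by simp))

theorem IsMultiplicativeBasis.finite_component_ne_zero [Algebra.FiniteType K B]
    (hb : IsMultiplicativeBasis b) (D : Derivation K B B) :
    {e | hb.component wt D e ≠ 0}.Finite := by
  classical
  obtain ⟨E, hE⟩ := hb.exists_finset_closure_eq_top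
  refine (E.biUnion fun m => (b.repr (D (b m))).support.image
    fun m' => wt m' - wt m).finite_toSet.subset fun e he => ?_
  by_contra hmem
  refine he (derivation_eq_zero_of_basis b fun m => ?_)
  have hm : m ∈ AddSubmonoid.closure (E : Set M) := hE ▸ AddSubmonoid.mem_top m
  induction hm using AddSubmonoid.closure_induction with
  | mem m hm =>
    rw [hb.component_basis]
    refine b.repr.map_eq_zero_iff.mp (Finsupp.ext fun m' => ?_)
    rw [repr_homogeneousPart, Finsupp.zero_apply]
    split_ifs with h
    · by_contra h'
      refine hmem (Finset.mem_biUnion.mpr ⟨m, hm, Finset.mem_image.mpr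
        ⟨m', Finsupp.mem_support_iff.mpr h', ?_⟩⟩)
      rw [h, add_sub_cancel_left]
    · rfl
  | zero => rw [hb.map_zero, Derivation.map_one_eq_zero]
  | add m m' _ _ h h' => rw [hb.map_add, Derivation.leibniz, h, h', smul_zero, smul_zero, add_zero]

/-- A nonzero locally nilpotent derivation has a nonzero homogeneous component that is locally
nilpotent: the one of largest degree in the lexicographic order. -/
theorem IsWeightBasis.exists_homogeneous_LND [CharZero K] [Algebra.FiniteType K B]
    (hb : IsWeightBasis ρ wt b) {D : Derivation K B B} (hD : D ∈ LND K B) (hD0 : D ≠ 0) :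
    ∃ D' ∈ LNDh ρ, D' ≠ 0 ∧ ∀ m, D (b m) = 0 → D' (b m) = 0 := by
  have hbm := hb.toIsMultiplicativeBasis
  have hne : {e | hbm.component wt D e ≠ 0}.Nonempty := by
    by_contra! hempty
    refine hD0 (derivation_eq_zero_of_basis b fun m =>
      b.repr.map_eq_zero_iff.mp (Finsupp.ext fun m' => ?_))
    by_contra h
    exact Set.eq_empty_iff_forall_notMem.mp hempty _ (hbm.component_sub_ne_zero h)
  obtain ⟨e, he, hmax⟩ :=
    Set.exists_max_image _ (toLex : (Fin n → ℤ) → Lex (Fin n → ℤ))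
      (hbm.finite_component_ne_zero (wt := wt) D) hne
  let T := hbm.component wt D e
  -- `V μ` is spanned by the weights `≤ μ`: `D` maps it to `V (μ + e)`, and the component of degree
  -- `e` of `D` is the map which `D` induces on the leading parts.
  let V : (Fin n → ℤ) → Submodule K B := fun μ =>
    Submodule.span K (b '' {m | toLex (wt m) ≤ toLex μ})
  have hle : ∀ {m m'}, b.repr (D (b m)) m' ≠ 0 → toLex (wt m') ≤ toLex (wt m) + toLex e := by
    intro m m' h
    have := hmax _ (hbm.component_sub_ne_zero h)
    rw [toLex_sub] at this
    exact sub_le_iff_le_add'.mp this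
  have hDV : ∀ {μ x}, x ∈ V μ → D x ∈ V (μ + e) := by
    intro μ x hx
    induction hx using Submodule.span_induction with
    | zero => rw [map_zero]; exact zero_mem _
    | add x y _ _ hx hy => rw [map_add]; exact add_mem hx hy
    | smul c x _ hx => rw [D.map_smul]; exact Submodule.smul_mem _ _ hx
    | mem x hx =>
      obtain ⟨m, hm, rfl⟩ := hx
      refine b.mem_span_image.mpr fun m' hm' => ?_
      exact (hle (Finsupp.mem_support_iff.mp hm')).trans (add_le_add_left hm _)
  have hDT : ∀ {μ x}, x ∈ V μ →
      T (homogeneousPart b wt μ x) = homogeneousPart b wt (μ + e) (D x) := by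
    intro μ x hx
    induction hx using Submodule.span_induction with
    | zero => simp only [map_zero]
    | add x y _ _ hx hy => simp only [map_add, hx, hy]
    | smul c x _ hx => simp only [map_smul, Derivation.map_smul, hx]
    | mem x hx =>
      obtain ⟨m, hm, rfl⟩ := hx
      rw [homogeneousPart_basis]
      split_ifs with h
      · rw [← h]
        exact hbm.component_basis D e m
      · rw [map_zero]
        refine (b.repr.map_eq_zero_iff.mp (Finsupp.ext fun m' => ?_)).symm
        rw [repr_homogeneousPart, Finsupp.zero_apply]
        split_ifs with h'
        · by_contra h''
          have h1 := hle h''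
          rw [h', toLex_add] at h1
          exact h (toLex_inj.mp (le_antisymm hm (le_of_add_le_add_right h1)))
        · rfl
  have hiter : ∀ m k, (D : B → B)^[k] (b m) ∈ V (wt m + k • e) ∧
      (T : B → B)^[k] (b m) = homogeneousPart b wt (wt m + k • e) ((D : B → B)^[k] (b m)) := by
    intro m k
    induction k with
    | zero =>
      rw [zero_nsmul, add_zero]
      refine ⟨Submodule.subset_span ⟨m, le_refl (toLex (wt m)), rfl⟩, ?_⟩
      exact ((homogeneousPart_basis (wt m) m).trans (if_pos rfl)).symm
    | succ k ih =>
      rw [Function.iterate_succ_apply', Function.iterate_succ_apply', succ_nsmul, ← add_assoc,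
        ih.2, hDT ih.1]
      exact ⟨hDV ih.1, rfl⟩
  refine ⟨T, ⟨mem_LND_of_basis b fun m => ?_, hb.isHomogeneous_component D e⟩, he, fun m hm => ?_⟩
  · obtain ⟨k, hk⟩ := hD (b m)
    exact ⟨k, by rw [(hiter m k).2, hk, map_zero]⟩
  · change hbm.component wt D e (b m) = 0
    rw [hbm.component_basis, hm, map_zero]

end Components

/-! ### Rigidity -/

section Rigidity

variable {K : Type*} [Field K] [CharZero K] {n : ℕ} {B : Type*} [CommRing B] [IsDomain B]
  [Algebra K B] {ρ : Torus K n →* (B ≃ₐ[K] B)} {M : Type*} [AddCommMonoid M]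
  {wt : M →+ (Fin n → ℤ)} {b : Basis M K B}

omit [CharZero K] [IsDomain B] in
theorem MLh_le_MLhStar : MLh ρ ≤ MLhStar ρ := fun _ hx D hD => hx D hD.1

omit [CharZero K] [IsDomain B] in
/-- A derivation `∂` of `A` extends to the derivation of `B = A[b (q m)]` that annihilates all
`b (q m)`; here `M` is the direct sum of the image `F` of `p` and the image of `q`, and `A` is spanned
by the `b m` with `m ∈ F`. -/
theorem exists_extension_derivation (hb : IsWeightBasis ρ wt b) {A : Subalgebra K B}
    (hA : IsFaceSubalgebra b A) {p q : M →+ M} (hpq : ∀ m, p m + q m = m)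
    (hpA : ∀ m, b (p m) ∈ A) (hfix : ∀ m, b m ∈ A → p m = m) (d : Derivation K A A) :
    ∃ D : Derivation K B B, (∀ a : A, D a = d a) ∧ ∀ m, D (b (q m)) = 0 := by
  have hbm := hb.toIsMultiplicativeBasis
  let y : M → A := fun m => ⟨b (p m), hpA m⟩
  have hy : ∀ m m', y (m + m') = y m * y m' := fun m m' => Subtype.ext (by
    change b (p (m + m')) = b (p m) * b (p m')
    rw [map_add, hb.map_add])
  have hq : ∀ m, p m = m → q m = 0 := fun m hm => by
    refine hb.add_left_cancel' (m := m) ?_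
    rw [add_zero]
    have h := hpq m
    rwa [hm] at h
  have hpq0 : ∀ m, p (q m) = 0 := fun m => by
    refine hb.add_left_cancel' (m := p m) ?_
    nth_rewrite 1 [← hfix _ (hpA m)]
    rw [← map_add, hpq, add_zero]
  have hy0 : ∀ m, p m = 0 → y m = 1 := fun m hm => Subtype.ext (by
    change b (p m) = 1
    rw [hm, hb.map_zero])
  let D := hbm.derivation (fun m => (d (y m) : B) * b (q m)) fun m m' => by
    have h : ∀ m, b m = y m * b (q m) := fun m => by
      change b m = b (p m) * b (q m)
      rw [← hb.map_add, hpq]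
    rw [hy, d.leibniz, map_add, hb.map_add, h m, h m']
    push_cast [smul_eq_mul]
    ring
  have hD : ∀ m, D (b m) = (d (y m) : B) * b (q m) := hbm.derivation_apply _ _
  refine ⟨D, fun a => ?_, fun m => ?_⟩
  · have : (D : B →ₗ[K] B) ∘ₗ A.val.toLinearMap = A.val.toLinearMap ∘ₗ (d : A →ₗ[K] A) := by
      refine (hA.basis hbm).ext fun m => ?_
      change D (hA.basis hbm m : B) = (d (hA.basis hbm m) : B)
      have hm := hfix m m.2
      have hym : y m = hA.basis hbm m := Subtype.ext (by
        rw [hA.coe_basis]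
        change b (p m) = b m
        rw [hm])
      rw [hA.coe_basis, hD, hym, hq _ hm, hb.map_zero, mul_one]
    exact LinearMap.congr_fun this a
  · rw [hD, hy0 _ (hpq0 m), d.map_one_eq_zero]
    simp

/-- If `ML^*_h` is equal to `ML_h`, then it has no nonzero locally nilpotent derivation: an extension
of it to `B` has a nonzero homogeneous locally nilpotent component, which cannot vanish on `ML^*_h`. -/
theorem IsWeightBasis.isRigid_of_eq [Algebra.FiniteType K B] (hb : IsWeightBasis ρ wt b)
    (heq : MLhStar ρ = MLh ρ) : IsRigid K (MLhStar ρ) := by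
  intro d hd
  by_contra hd0
  have hA : IsFaceSubalgebra b (MLhStar ρ) :=
    hb.isFaceSubalgebra_kernels Set.inter_subset_left
  obtain ⟨p, q, hpq, hpA, hfix⟩ := hb.exists_retraction_MLhStar
  obtain ⟨D, hDd, hDq⟩ := exists_extension_derivation hb hA hpq hpA hfix d
  have hb' : ∀ m, b m = b (p m) * b (q m) := fun m => by rw [← hb.map_add, hpq]
  have hiter : ∀ (a : MLhStar ρ) m k, (D : B → B)^[k] (a * b (q m)) =
      ((d : MLhStar ρ → MLhStar ρ)^[k] a : B) * b (q m) := by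
    intro a m k
    induction k with
    | zero => rfl
    | succ k ih =>
      rw [Function.iterate_succ_apply', ih, D.leibniz, hDq, hDd, smul_zero, zero_add, smul_eq_mul,
        mul_comm, Function.iterate_succ_apply']
  have hD : D ∈ LND K B := mem_LND_of_basis b fun m => by
    obtain ⟨k, hk⟩ := hd ⟨b (p m), hpA m⟩
    refine ⟨k, ?_⟩
    have h := hiter ⟨b (p m), hpA m⟩ m k
    rw [hk, ZeroMemClass.coe_zero, zero_mul] at h
    rw [hb' m]
    exact h
  have hD0 : D ≠ 0 := by
    rintro rfl
    exact hd0 (Derivation.ext fun a => Subtype.ext (hDd a).symm)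
  obtain ⟨D', hD', hD'0, hker⟩ := hb.exists_homogeneous_LND hD hD0
  refine hD'0 (derivation_eq_zero_of_basis b fun m => ?_)
  have hp : D' (b (p m)) = 0 := (heq ▸ hpA m : b (p m) ∈ MLh ρ) D' hD'
  rw [hb' m, D'.leibniz, hp, hker _ (hDq m), smul_zero, smul_zero, add_zero]

/-- If `ML^*_h` is rigid, then every homogeneous locally nilpotent derivation `D` of `B` vanishes on
it: composed with the projection induced by `p`, the restriction of `D` to `ML^*_h` is a derivation
of `ML^*_h` which lowers the degree function of `D`, hence is locally nilpotent. -/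
theorem IsWeightBasis.eq_of_isRigid (hb : IsWeightBasis ρ wt b)
    (hrigid : IsRigid K (MLhStar ρ)) : MLhStar ρ = MLh ρ := by
  refine le_antisymm ?_ MLh_le_MLhStar
  rintro x hx D ⟨hD, hDh⟩
  have hbm := hb.toIsMultiplicativeBasis
  have hA : IsFaceSubalgebra b (MLhStar ρ) :=
    hb.isFaceSubalgebra_kernels Set.inter_subset_left
  obtain ⟨p, q, hpq, hpA, hfix⟩ := hb.exists_retraction_MLhStar
  let P : B →ₐ[K] MLhStar ρ := hbm.algHom (fun m => ⟨b (p m), hpA m⟩)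
    (Subtype.ext (by
      change b (p 0) = 1
      rw [map_zero, hb.map_zero]))
    fun m m' => Subtype.ext (by
      change b (p (m + m')) = b (p m) * b (p m')
      rw [map_add, hb.map_add])
  have hP : ∀ m, P (b m) = ⟨b (p m), hpA m⟩ := hbm.algHom_apply _ _ _
  have hPid : ∀ a : MLhStar ρ, P a = a := by
    intro a
    have : P.toLinearMap ∘ₗ (MLhStar ρ).val.toLinearMap = LinearMap.id := by
      refine (hA.basis hbm).ext fun m => ?_
      change P (hA.basis hbm m : B) = hA.basis hbm m
      refine Subtype.ext ?_
      rw [hA.coe_basis, hP]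
      change b (p m) = b m
      rw [hfix m m.2]
    exact LinearMap.congr_fun this a
  let d : Derivation K (MLhStar ρ) (MLhStar ρ) :=
    Derivation.mk' (P.toLinearMap ∘ₗ (D : B →ₗ[K] B) ∘ₗ (MLhStar ρ).val.toLinearMap) fun a a' => by
      change P (D ((a : B) * (a' : B))) = a • P (D (a' : B)) + a' • P (D (a : B))
      rw [D.leibniz, smul_eq_mul, smul_eq_mul, map_add, map_mul, map_mul, hPid, hPid, smul_eq_mul,
        smul_eq_mul]
  have hd : ∀ a : MLhStar ρ, d a = P (D (a : B)) := fun _ => rfl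
  -- Each `D (b m)` is a multiple `c • b m'` of a basis element, which `P` maps to
  -- `c • b (p m')`.
  have hDb : ∀ m, D (b m) = 0 ∨ ∃ (m' : M) (c : K), c ≠ 0 ∧ D (b m) = c • b m' := by
    intro m
    obtain ⟨e, hDe⟩ := hDh
    by_cases h0 : D (b m) = 0
    · exact Or.inl h0
    · obtain ⟨m', -, c, hc, h⟩ := hb.exists_eq_smul_basis (hDe _ _ (hb.basis_mem_weightSpace m)) h0
      exact Or.inr ⟨m', c, hc, h⟩
  have hnil : ∀ k m (hm : b m ∈ MLhStar ρ), (D : B → B)^[k] (b m) = 0 →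
      ∃ j, (d : MLhStar ρ → MLhStar ρ)^[j] ⟨b m, hm⟩ = 0 := by
    intro k
    induction k with
    | zero => exact fun m _ h => absurd h (b.ne_zero m)
    | succ k ih =>
      intro m hm hk
      rcases hDb m with h0 | ⟨m', c, hc, h⟩
      · refine ⟨1, ?_⟩
        rw [Function.iterate_one, hd, h0, map_zero]
      · rw [Function.iterate_succ_apply, h, iterate_smul] at hk
        have hk' := (smul_eq_zero.mp hk).resolve_left hc
        -- `b (p m')` divides `b m'`, so its degree with respect to `D` is at most that of `b m'`.
        rw [← hpq m', hb.map_add] at hk'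
        obtain ⟨j, hj⟩ := ih (p m') (hpA m') (iterate_eq_zero_of_mul hD (b.ne_zero _) hk')
        refine ⟨j + 1, ?_⟩
        rw [Function.iterate_succ_apply, hd, h, map_smul, hP, iterate_smul, hj, smul_zero]
  have hd0 : d = 0 := by
    refine hrigid d (mem_LND_of_basis (hA.basis hbm) fun m => ?_)
    obtain ⟨k, hk⟩ := hD (b m)
    have hm : hA.basis hbm m = ⟨b m, m.2⟩ := Subtype.ext (hA.coe_basis hbm m)
    rw [hm]
    exact hnil k m m.2 hk
  have hDA : (D : B →ₗ[K] B) ∘ₗ (MLhStar ρ).val.toLinearMap = 0 := by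
    refine (hA.basis hbm).ext fun m => ?_
    change D (hA.basis hbm m : B) = 0
    rw [hA.coe_basis]
    rcases hDb m with h0 | ⟨m', c, hc, h⟩
    · exact h0
    · have h1 : P (D (b m)) = 0 := by
        have := hd ⟨b m, m.2⟩
        rw [hd0] at this
        exact this.symm
      rw [h, map_smul, hP] at h1
      exact absurd (congrArg Subtype.val ((smul_eq_zero.mp h1).resolve_left hc)) (b.ne_zero _)
  exact LinearMap.congr_fun hDA ⟨x, hx⟩

end Rigidity

end AffineToric

theorem corollary5p9 {K : Type*} [Field K] [IsAlgClosed K] [CharZero K] {n : ℕ}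
    {B : Type*} [CommRing B] [Algebra K B]
    (ρ : AffineToric.Torus K n →* (B ≃ₐ[K] B)) (hX : AffineToric.IsAffineToric K ρ) :
    -- `ML^*_h(X)` is `T`-stable, and it is the coordinate ring of an affine toric variety `X'`,
    -- which is a closed `T`-stable subvariety of `X`
    (∃ ρ' : AffineToric.Torus K n →*
        (AffineToric.MLhStar ρ ≃ₐ[K] AffineToric.MLhStar ρ),
      (∀ t a, (ρ' t a : B) = ρ t (a : B)) ∧
      AffineToric.IsAffineToric K ρ' ∧
      ∃ π : B →ₐ[K] AffineToric.MLhStar ρ,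
        Function.Surjective π ∧ ∀ t b, π (ρ t b) = ρ' t (π b)) ∧
    -- `X'` is rigid if and only if `ML^*_h(X) = ML_h(X)`
    (AffineToric.IsRigid K (AffineToric.MLhStar ρ) ↔
      AffineToric.MLhStar ρ = AffineToric.MLh ρ) := by
  have := hX.isDomain
  have := hX.finiteType
  obtain ⟨S, b, hb⟩ := AffineToric.exists_isWeightBasis hX
  have hA : AffineToric.IsFaceSubalgebra b (AffineToric.MLhStar ρ) :=
    hb.isFaceSubalgebra_kernels Set.inter_subset_left
  exact ⟨⟨AffineToric.restrictAction ρ _ (hA.apply_mem hb), fun _ _ => rfl,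
    hA.isAffineToric hX hb, hA.proj hb.toIsMultiplicativeBasis, fun x => ⟨x, hA.proj_coe _ x⟩,
    fun t x => hA.proj_apply hb t x⟩, hb.eq_of_isRigid, hb.isRigid_of_eq⟩
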